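/- Here a digraph is a finite directed graph without loops and without parallel arcs (opposite arcs $u\to v$ and $v\to u$ may both be present), and a directed tree is an orientation of a finite undirected tree, so that each edge carries exactly one direction. For a digraph $H$ and $v\in V(H)$ let $d(v)$ be the total degree of $v$, that is, its in-degree plus its out-degree. $\mathrm{Hom}(T,H)$ denotes the set of maps $\varphi:V(T)\to V(H)$ such that $\varphi(a)\to\varphi(b)$ is an arc of $H$ whenever $a\to b$ is an arc of $T$. The convention $0^0=1$ is used. **Theorem (Directed tail inequality).** Let $T$ be a directed tree on $k\ge 1$ vertices with root $o\in V(T)$, let $H$ be a digraph, let $\Delta\ge 0$ be a real number, and let $\boldsymbol\alpha=(\alpha_x)_{x\in V(T)}\in[0,\infty)^{V(T)}$, with $|\boldsymbol\alpha|:=\sum_{x\in V(T)}\alpha_x$. Then $$\sum_{\varphi\in\mathrm{Hom}(T,H)}\mathbb 1\{d(\varphi(o))\ge\Delta\}\prod_{x\in V(T)}d(\varphi(x))^{\alpha_x}\;\le\;4\sum_{v\in V(H)}d(v)^{k-1+|\boldsymbol\alpha|}\,\mathbb 1\{d(v)\ge\Delta\}.$$ Moreover, in the unweighted case, $$\bigl|\{\varphi\in\mathrm{Hom}(T,H):d(\varphi(o))\ge\Delta\}\bigr|\;\le\;2\sum_{v\in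 V(H)}d(v)^{k-1}\,\mathbb 1\{d(v)\ge\Delta\}.$$ -/

import Mathlib

open scoped BigOperators

noncomputable section

namespace DirectedTail

/-- A digraph without loops. Opposite arcs `u → v` and `v → u` may both be present; parallel arcs
cannot occur, since `Adj` is a relation. -/
def IsLoopless {V : Type*} (H : Digraph V) : Prop :=
  ∀ v, ¬ H.Adj v v

/-- A directed tree is an orientation of a tree: at most one of `a → b` and `b → a` is an arc
(for `a = b`: there are no loops), and the underlying undirected simple graph is a tree. -/
structure IsDirectedTree {W : Type*} (T : Digraph W) : Prop where
  asymm : ∀ a b, T.Adj a b → ¬ T.Adj b a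
  isTree : T.toSimpleGraphInclusive.IsTree

open Classical in
/-- The number of arcs ending at `v`. -/
def inDegree {V : Type*} [Fintype V] (H : Digraph V) (v : V) : ℕ :=
  (Finset.univ.filter fun u => H.Adj u v).card

open Classical in
/-- The number of arcs starting at `v`. -/
def outDegree {V : Type*} [Fintype V] (H : Digraph V) (v : V) : ℕ :=
  (Finset.univ.filter fun u => H.Adj v u).card

/-- The total degree `d(v)`. -/
def totalDegree {V : Type*} [Fintype V] (H : Digraph V) (v : V) : ℕ :=
  inDegree H v + outDegree H v

/-- `φ` is a digraph homomorphism: it maps arcs to arcs. -/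
def IsHom {W V : Type*} (T : Digraph W) (H : Digraph V) (φ : W → V) : Prop :=
  ∀ a b, T.Adj a b → H.Adj (φ a) (φ b)

open Classical in
/-- The finite set `Hom(T, H)`. -/
def homSet {W V : Type*} [Fintype W] [Fintype V] (T : Digraph W) (H : Digraph V) :
    Finset (W → V) :=
  Finset.univ.filter fun φ => IsHom T H φ

open Classical in
/-- `hom_Δ(T, H)`: the number of homomorphisms whose root image has total degree at least `Δ`. -/
def tailHom {W V : Type*} [Fintype W] [Fintype V] (T : Digraph W) (o : W) (H : Digraph V)
    (Δ : ℝ) : ℕ :=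
  ((homSet T H).filter fun φ => Δ ≤ (totalDegree H (φ o) : ℝ)).card

/-- `hom_{Δ, α}(T, H)`: the weighted count, where `φ` has weight `∏ x, d(φ x) ^ α x`. -/
def weightedTailHom {W V : Type*} [Fintype W] [Fintype V] (T : Digraph W) (o : W)
    (H : Digraph V) (Δ : ℝ) (α : W → ℝ) : ℝ :=
  ∑ φ ∈ homSet T H, (if Δ ≤ (totalDegree H (φ o) : ℝ) then 1 else 0) *
    ∏ x, (totalDegree H (φ x) : ℝ) ^ α x

end DirectedTail

end

namespace DirectedTail

open Finset

/-! Both inequalities hold with constant `1`. For the unweighted one, induct on the tree by deleting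
a leaf other than the root `o`: if its neighbour is `y`, each map of the smaller tree has at most `d
(φ y)` extensions. This leaves a sum of `d (φ y)` over maps with `d (φ o) ≥ m`. The induction
hypothesis holds for every root and threshold, so it bounds the tails of both `d (φ o)` and `d (φ
y)`, and `sum_filter_le_of_tail_le` turns these tail bounds into a bound on the mixed sum without
loss.

The same comparison with `g n = n ^ a` handles a weight at a single vertex, and weighted AM-GM
reduces a product of weights to that case. -/

/-- Layer-cake comparison: if the tails of `X` over `s`, and the number of `i ∈ s` with `m ≤ Y i`,
are bounded by the `w`-weighted tails of `d` over `t`, then so is the sum of `g (X i)` over those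
`i ∈ s` with `m ≤ Y i`, for every monotone `g` that is nonnegative at `m`. -/
theorem sum_filter_le_of_tail_le {ι κ : Type*} (s : Finset ι) (t : Finset κ) (X Y : ι → ℕ)
    (d : κ → ℕ) (w : κ → ℝ) (m : ℕ) (g : ℕ → ℝ) (hg : Monotone g) (hm : 0 ≤ g m)
    (hY : (#{i ∈ s | m ≤ Y i} : ℝ) ≤ ∑ v ∈ t with m ≤ d v, w v)
    (hX : ∀ n, m ≤ n → (#{i ∈ s | n ≤ X i} : ℝ) ≤ ∑ v ∈ t with n ≤ d v, w v) :
    ∑ i ∈ s with m ≤ Y i, g (X i) ≤ ∑ v ∈ t with m ≤ d v, w v * g (d v) := by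
  obtain ⟨N, hXN, hdN⟩ : ∃ N, (∀ i ∈ s, X i ≤ N) ∧ ∀ v ∈ t, d v ≤ N :=
    ⟨max (s.sup X) (t.sup d), fun i hi => (le_sup hi).trans (le_max_left _ _),
      fun v hv => (le_sup hv).trans (le_max_right _ _)⟩
  -- Truncating below at `m` leaves only increments at levels above `m`, the only levels where `hX`
  -- is available.
  have key : ∀ n ≤ N, g (max m n) =
      g m + ∑ j ∈ Ico m N, if j + 1 ≤ n then g (j + 1) - g j else 0 := by
    intro n hn
    rw [← sum_filter]
    have : {j ∈ Ico m N | j + 1 ≤ n} = Ico m (max m n) := by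
      ext j; simp only [mem_filter, mem_Ico, lt_max_iff]; omega
    rw [this, sum_Ico_eq_sub _ (le_max_left _ _), sum_range_sub, sum_range_sub]
    ring
  calc ∑ i ∈ s with m ≤ Y i, g (X i)
      ≤ ∑ i ∈ s with m ≤ Y i,
          (g m + ∑ j ∈ Ico m N, if j + 1 ≤ X i then g (j + 1) - g j else 0) := by
        refine sum_le_sum fun i hi => ?_
        rw [← key _ (hXN i (mem_filter.1 hi).1)]
        exact hg (le_max_right _ _)
    _ = g m * #{i ∈ s | m ≤ Y i} + ∑ j ∈ Ico m N,
          (g (j + 1) - g j) * #{i ∈ s | m ≤ Y i ∧ j + 1 ≤ X i} := by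
        rw [sum_add_distrib, sum_comm]
        congr 1
        · rw [sum_const, nsmul_eq_mul, mul_comm]
        · refine sum_congr rfl fun j _ => ?_
          rw [← sum_filter, filter_filter, sum_const, nsmul_eq_mul, mul_comm]
    _ ≤ g m * (∑ v ∈ t with m ≤ d v, w v) + ∑ j ∈ Ico m N,
          (g (j + 1) - g j) * ∑ v ∈ t with j + 1 ≤ d v, w v := by
        -- The constraint on `Y` is used only in the base term `g m`; in the increments it is
        -- dropped.
        refine add_le_add (mul_le_mul_of_nonneg_left hY hm) (sum_le_sum fun j hj => ?_)
        refine mul_le_mul_of_nonneg_left (le_trans ?_ (hX (j + 1) ?_))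
          (sub_nonneg.2 (hg j.le_succ))
        · refine Nat.cast_le.2 (card_le_card fun i hi => ?_)
          rw [mem_filter] at hi ⊢
          exact ⟨hi.1, hi.2.2⟩
        · exact (mem_Ico.1 hj).1.trans j.le_succ
    _ = ∑ v ∈ t with m ≤ d v,
          w v * (g m + ∑ j ∈ Ico m N, if j + 1 ≤ d v then g (j + 1) - g j else 0) := by
        simp_rw [mul_add, mul_sum]
        rw [sum_add_distrib, sum_comm]
        congr 1
        · exact sum_congr rfl fun v _ => mul_comm _ _
        · refine sum_congr rfl fun j hj => ?_
          simp_rw [mul_ite, mul_zero]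
          rw [← sum_filter, filter_filter]
          refine sum_congr ?_ fun v _ => mul_comm _ _
          ext v
          have := (mem_Ico.1 hj).1
          simp only [mem_filter]
          exact and_congr_right fun _ => by omega
    _ = ∑ v ∈ t with m ≤ d v, w v * g (d v) := by
        refine sum_congr rfl fun v hv => ?_
        rw [mem_filter] at hv
        rw [← key _ (hdN v hv.1), max_eq_right hv.2]

open Classical in
/-- The maps `φ` such that `R a b (φ a) (φ b)` holds along every edge `ab` of `G`. -/
noncomputable def edgeMaps {W V : Type*} [Fintype W] [Fintype V] (G : SimpleGraph W)
    (R : W → W → V → V → Prop) : Finset (W → V) :=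
  {φ | ∀ a b, G.Adj a b → R a b (φ a) (φ b)}

theorem mem_edgeMaps {W V : Type*} [Fintype W] [Fintype V] {G : SimpleGraph W}
    {R : W → W → V → V → Prop} {φ : W → V} :
    φ ∈ edgeMaps G R ↔ ∀ a b, G.Adj a b → R a b (φ a) (φ b) := by
  simp [edgeMaps]

/-- Removing a vertex `l` with neighbour `y`: each map on the remaining vertices has at most
`d (φ y)` extensions to `l`. -/
theorem card_edgeMaps_filter_le {W V : Type*} [Fintype W] [Fintype V] (G : SimpleGraph W)
    (R : W → W → V → V → Prop) (d : V → ℕ)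
    (hd : ∀ a b, G.Adj a b → ∀ v, Nat.card {u // R a b v u} ≤ d v) (m : ℕ)
    (l : W) [Fintype ({l}ᶜ : Set W)] (o y : ({l}ᶜ : Set W)) (hyl : G.Adj y l) :
    #{φ ∈ edgeMaps G R | m ≤ d (φ o)} ≤
      ∑ φ ∈ edgeMaps (G.induce {l}ᶜ) (fun a b => R a b) with m ≤ d (φ o), d (φ y) := by
  classical
  set B := {φ ∈ edgeMaps (G.induce {l}ᶜ) (fun a b => R a b) | m ≤ d (φ o)}
  have hinj : Function.Injective
      fun φ : W → V => (⟨fun x : ({l}ᶜ : Set W) => φ x, φ l⟩ : (_ : ({l}ᶜ : Set W) → V) × V) := by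
    intro φ ψ h
    simp only [Sigma.mk.injEq, heq_eq_eq] at h
    funext x
    by_cases hx : x = l
    · rw [hx, h.2]
    · exact congrFun h.1 ⟨x, hx⟩
  calc #{φ ∈ edgeMaps G R | m ≤ d (φ o)}
      ≤ #(B.sigma fun φ => {u | R y l (φ y) u}) := by
        refine card_le_card_of_injOn _ (fun φ hφ => ?_) hinj.injOn
        simp only [mem_edgeMaps, coe_filter, Set.mem_ofPred_eq] at hφ
        simp only [B, mem_edgeMaps, coe_sigma, Set.mem_sigma_iff, coe_filter, mem_univ,
          true_and, Set.mem_ofPred_eq]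
        exact ⟨⟨fun a b hab => hφ.1 a b hab, hφ.2⟩, hφ.1 _ _ hyl⟩
    _ = ∑ φ ∈ B, #{u | R y l (φ y) u} := card_sigma _ _
    _ ≤ ∑ φ ∈ B, d (φ y) := by
        refine sum_le_sum fun φ _ => ?_
        refine le_trans (le_of_eq ?_) (hd _ _ hyl (φ y))
        rw [Nat.card_eq_fintype_card, Fintype.card_subtype]

/-- Unweighted tail inequality for trees on `k + 1` vertices, with constant `1`. -/
theorem card_edgeMaps_le {V : Type*} [Fintype V] (d : V → ℕ) (k : ℕ) :
    ∀ {W : Type*} [Fintype W] (G : SimpleGraph W), G.IsTree → Fintype.card W = k + 1 →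
      ∀ R : W → W → V → V → Prop,
      (∀ a b, G.Adj a b → ∀ v, Nat.card {u // R a b v u} ≤ d v) → ∀ (o : W) (m : ℕ),
      #{φ ∈ edgeMaps G R | m ≤ d (φ o)} ≤ ∑ v with m ≤ d v, d v ^ k := by
  induction k with
  | zero =>
    intro W _ G _ hW R _ o m
    have : Subsingleton W := Fintype.card_le_one_iff_subsingleton.1 hW.le
    simp only [pow_zero, sum_const, smul_eq_mul, mul_one]
    refine card_le_card_of_injOn (fun φ => φ o) (fun φ hφ => ?_) fun φ _ ψ _ h => ?_
    · simpa using (mem_filter.1 hφ).2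
    · funext x
      rw [Subsingleton.elim x o]
      exact h
  | succ k ih =>
    intro W _ G hG hW R hd o m
    classical
    have : Nontrivial W := Fintype.one_lt_card_iff_nontrivial.1 (by omega)
    -- A nontrivial tree has two leaves, so one of them is not the root.
    obtain ⟨l, hlo, hl⟩ : ∃ l, l ≠ o ∧ G.degree l = 1 := by
      obtain ⟨a, b, hab, ha, hb⟩ := hG.exists_ne_and_degree_eq_one
      by_cases h : a = o
      · exact ⟨b, h ▸ hab.symm, hb⟩
      · exact ⟨a, h, ha⟩
    obtain ⟨y, hly, -⟩ := SimpleGraph.degree_eq_one_iff_existsUnique_adj.1 hl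
    have hT : (G.induce {l}ᶜ).IsTree :=
      ⟨hG.connected.induce_compl_singleton_of_degree_eq_one hl, hG.isAcyclic.induce _⟩
    have hcard : Fintype.card ({l}ᶜ : Set W) = k + 1 := by
      rw [Fintype.card_compl_set, hW, Set.card_singleton]; rfl
    have ih' := fun (x : ({l}ᶜ : Set W)) (n : ℕ) =>
      ih (G.induce {l}ᶜ) hT hcard (fun a b => R a b) (fun a b hab => hd a b hab) x n
    refine (card_edgeMaps_filter_le G R d hd m l ⟨o, hlo.symm⟩ ⟨y, hly.ne'⟩ hly.symm).trans ?_
    -- The induction hypothesis enters twice: rooted at `o` with threshold `m`, and rooted at `y`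
    -- with every threshold `n ≥ m`.
    have := sum_filter_le_of_tail_le (edgeMaps (G.induce {l}ᶜ) (fun a b => R a b)) univ
      (fun φ => d (φ ⟨y, hly.ne'⟩)) (fun φ => d (φ ⟨o, hlo.symm⟩)) d (fun v => (d v : ℝ) ^ k) m
      (fun n => (n : ℝ)) Nat.mono_cast (Nat.cast_nonneg m)
      (by exact_mod_cast ih' ⟨o, hlo.symm⟩ m) (fun n _ => by exact_mod_cast ih' ⟨y, hly.ne'⟩ n)
    simp_rw [pow_succ]
    exact_mod_cast this

/-- Along an edge, the image of the next vertex is an out-neighbour or an in-neighbour of the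
current image, according to the orientation; the total degree bounds either number of choices. -/
theorem card_homSet_filter_le {W V : Type*} [Fintype W] [Fintype V] (T : Digraph W)
    (hT : IsDirectedTree T) (o : W) (H : Digraph V) (m : ℕ) :
    #{φ ∈ homSet T H | m ≤ totalDegree H (φ o)} ≤
      ∑ v with m ≤ totalDegree H v, totalDegree H v ^ (Fintype.card W - 1) := by
  classical
  let R : W → W → V → V → Prop :=
    fun a b v u => (T.Adj a b → H.Adj v u) ∧ (T.Adj b a → H.Adj u v)
  have hpos : 0 < Fintype.card W := Fintype.card_pos_iff.2 ⟨o⟩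
  refine le_trans (card_le_card (filter_subset_filter _ fun φ hφ => ?_))
    (card_edgeMaps_le (totalDegree H) (Fintype.card W - 1) _ hT.isTree (by omega) R ?_ o m)
  · have hom : IsHom T H φ := (mem_filter.1 hφ).2
    exact mem_edgeMaps.2 (fun a b _ => ⟨hom a b, hom b a⟩)
  · intro a b hab v
    rw [Nat.card_eq_fintype_card, Fintype.card_subtype]
    rcases ((SimpleGraph.fromRel_adj _ _ _).1 hab).2 with h | h
    · refine le_trans (card_le_card (monotone_filter_right _ fun u _ hu => ?_))
        (Nat.le_add_left (outDegree H v) (inDegree H v))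
      exact hu.1 h
    · refine le_trans (card_le_card (monotone_filter_right _ fun u _ hu => ?_))
        (Nat.le_add_right (inDegree H v) (outDegree H v))
      exact hu.2 h

/-- Layer-cake comparison again, fed by the unweighted inequality rooted at `o` and at `x`. -/
theorem sum_homSet_rpow_le {W V : Type*} [Fintype W] [Fintype V] (T : Digraph W)
    (hT : IsDirectedTree T) (o x : W) (H : Digraph V) (m : ℕ) (a : ℝ) (ha : 0 ≤ a) :
    ∑ φ ∈ homSet T H with m ≤ totalDegree H (φ o), (totalDegree H (φ x) : ℝ) ^ a ≤
      ∑ v with m ≤ totalDegree H v,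
        (totalDegree H v : ℝ) ^ ((Fintype.card W : ℝ) - 1 + a) := by
  have hpos : 1 ≤ Fintype.card W := Fintype.card_pos_iff.2 ⟨o⟩
  have h := sum_filter_le_of_tail_le (homSet T H) univ (fun φ => totalDegree H (φ x))
    (fun φ => totalDegree H (φ o)) (totalDegree H)
    (fun v => (totalDegree H v : ℝ) ^ (Fintype.card W - 1)) m (fun n => (n : ℝ) ^ a)
    (fun i j hij => Real.rpow_le_rpow (Nat.cast_nonneg i) (Nat.cast_le.2 hij) ha)
    (Real.rpow_nonneg (Nat.cast_nonneg m) a)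
    (by exact_mod_cast card_homSet_filter_le T hT o H m)
    (fun n _ => by exact_mod_cast card_homSet_filter_le T hT x H n)
  refine h.trans_eq (sum_congr rfl fun v _ => ?_)
  have hk : (Fintype.card W : ℝ) - 1 = ((Fintype.card W - 1 : ℕ) : ℝ) := by
    rw [Nat.cast_sub hpos, Nat.cast_one]
  rw [hk, Real.rpow_add_of_nonneg (Nat.cast_nonneg _) (Nat.cast_nonneg _) ha, Real.rpow_natCast]

theorem sum_homSet_prod_rpow_le {W V : Type*} [Fintype W] [Fintype V] (T : Digraph W)
    (hT : IsDirectedTree T) (o : W) (H : Digraph V) (m : ℕ) (α : W → ℝ) (hα : ∀ x, 0 ≤ α x) :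
    ∑ φ ∈ homSet T H with m ≤ totalDegree H (φ o), ∏ x, (totalDegree H (φ x) : ℝ) ^ α x ≤
      ∑ v with m ≤ totalDegree H v,
        (totalDegree H v : ℝ) ^ ((Fintype.card W : ℝ) - 1 + ∑ x, α x) := by
  set a := ∑ x, α x with ha
  have ha0 : 0 ≤ a := sum_nonneg fun x _ => hα x
  -- The AM-GM weights `α x / a` require `a ≠ 0`; if `a = 0`, every factor is `1`.
  rcases ha0.eq_or_lt with h0 | h0
  · have hα0 : ∀ x, α x = 0 := fun x =>
      (sum_eq_zero_iff_of_nonneg fun x _ => hα x).1 (ha ▸ h0.symm) x (mem_univ x)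
    simpa [hα0, ← h0] using sum_homSet_rpow_le T hT o o H m 0 le_rfl
  have hsum : ∑ x, α x / a = 1 := by rw [← sum_div, ← ha, div_self h0.ne']
  calc ∑ φ ∈ homSet T H with m ≤ totalDegree H (φ o), ∏ x, (totalDegree H (φ x) : ℝ) ^ α x
      ≤ ∑ φ ∈ homSet T H with m ≤ totalDegree H (φ o),
          ∑ x, α x / a * (totalDegree H (φ x) : ℝ) ^ a := by
        refine sum_le_sum fun φ _ => ?_
        have := Real.geom_mean_le_arith_mean_weighted univ (fun x => α x / a)
          (fun x => (totalDegree H (φ x) : ℝ) ^ a) (fun x _ => div_nonneg (hα x) ha0) hsum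
          (fun x _ => Real.rpow_nonneg (Nat.cast_nonneg _) a)
        refine le_trans (le_of_eq (prod_congr rfl fun x _ => ?_)) this
        rw [← Real.rpow_mul (Nat.cast_nonneg _), mul_div_cancel₀ _ h0.ne']
    _ = ∑ x, α x / a * ∑ φ ∈ homSet T H with m ≤ totalDegree H (φ o),
          (totalDegree H (φ x) : ℝ) ^ a := by
        rw [sum_comm]
        simp_rw [mul_sum]
    _ ≤ ∑ x, α x / a * ∑ v with m ≤ totalDegree H v,
          (totalDegree H v : ℝ) ^ ((Fintype.card W : ℝ) - 1 + a) :=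
        sum_le_sum fun x _ => mul_le_mul_of_nonneg_left
          (sum_homSet_rpow_le T hT o x H m a ha0) (div_nonneg (hα x) ha0)
    _ = _ := by rw [← sum_mul, hsum, one_mul]

end DirectedTail

theorem mainTheorem2 {W V : Type*} [Fintype W] [Fintype V]
    (T : Digraph W) (hT : DirectedTail.IsDirectedTree T) (o : W)
    (H : Digraph V) (hH : DirectedTail.IsLoopless H)
    (Δ : ℝ) (hΔ : 0 ≤ Δ) :
    (∀ α : W → ℝ, (∀ x, 0 ≤ α x) →
      DirectedTail.weightedTailHom T o H Δ α ≤
        4 * ∑ v : V,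
          (DirectedTail.totalDegree H v : ℝ) ^ ((Fintype.card W : ℝ) - 1 + ∑ x, α x) *
            (if Δ ≤ (DirectedTail.totalDegree H v : ℝ) then 1 else 0)) ∧
    DirectedTail.tailHom T o H Δ ≤
      2 * ∑ v : V,
        DirectedTail.totalDegree H v ^ (Fintype.card W - 1) *
          (if Δ ≤ (DirectedTail.totalDegree H v : ℝ) then 1 else 0) := by
  classical
  -- Degrees are natural numbers, so the threshold `Δ` may be replaced by `⌈Δ⌉₊`.
  simp only [DirectedTail.weightedTailHom, DirectedTail.tailHom, ← Nat.ceil_le, ite_mul, mul_ite,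
    one_mul, zero_mul, mul_one, mul_zero, ← Finset.sum_filter]
  refine ⟨fun α hα => ?_, ?_⟩
  · refine (DirectedTail.sum_homSet_prod_rpow_le T hT o H _ α hα).trans ?_
    exact le_mul_of_one_le_left
      (Finset.sum_nonneg fun v _ => Real.rpow_nonneg (Nat.cast_nonneg _) _) (by norm_num)
  · have h := DirectedTail.card_homSet_filter_le T hT o H ⌈Δ⌉₊
    convert h.trans (Nat.le_mul_of_pos_left _ two_pos)
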